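/- Let $H(\mathbb{C})$ be the complex vector space of all entire functions with the topology of uniform convergence on compact sets, and let $D$ be the differentiation operator on it. An entire function $f$ is of exponential type if there are $A,B>0$ with $|f(z)|\le Ae^{B|z|}$ for all $z\in\mathbb{C}$; let $\mathcal{E}$ be the class of these functions. A set $U\subset\mathbb{C}$ is an $\mathcal{E}$-unicity set if every $f\in\mathcal{E}$ vanishing on $U$ is identically $0$. Let $(P_n)_{n\ge1}$ be a sequence of nonconstant complex polynomials, $P_n(z)=\sum_{j=m(n)}^{d(n)}c_{j,n}z^j$ with $c_{m(n),n}\ne0\ne c_{d(n),n}$, and put $c_{j,n}=0$ for $j>d(n)$. Assume that (a) the sequence $(m(n))$ is unbounded; (b) at least one of the following properties holds: - (P) there is an $\mathcal{E}$-unicity set $U\subset\mathbb{C}$ such that $\lim_{n\to\infty}|P_n(z)|=+\infty$ for all $z\in U$; - (Q) for each integer $k\ge1$, $\lim_{n\to\infty}m(n)\,|c_{m(n),n}|^{k/m(n)}=+\infty$ and the sequence $(c_{k+m(n),n})_{n\ge 1}$ is bounded; - (R) there is $r>0$ such that $\lim_{n\to\infty}\min\{|P_n(z)|:|z|=r\}=+\infty$.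 Let $HC((P_n(D)))$ be the set of all $f\in H(\mathbb{C})$ such that $\{P_n(D)f:n\ge1\}$ is dense in $H(\mathbb{C})$, where $P_n(D)f=\sum_{j}c_{j,n}f^{(j)}$. Then $HC((P_n(D)))$ is $\mathfrak{c}$-infinitely pointwise $\mathfrak{c}$-dense-lineable in $H(\mathbb{C})$, where $\mathfrak{c}$ is the cardinality of the continuum; that is, for every $f\in HC((P_n(D)))$ there is a family $\{W_k:k\in\Lambda\}$ of linear subspaces of $H(\mathbb{C})$, indexed by a set $\Lambda$ of cardinality $\mathfrak{c}$, such that each $W_k$ is dense in $H(\mathbb{C})$, $\dim(W_k)=\mathfrak{c}$, $f\in W_k\subset HC((P_n(D)))\cup\{0\}$, and $W_k\cap W_l=\operatorname{span}\{f\}$ whenever $k\neq l$. -/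

import Mathlib

open Filter Topology Polynomial

noncomputable section

universe u v

/-! ### The space of entire functions and the derivative operator -/

/-- The set of all entire functions, as a linear subspace of `C(ℂ, ℂ)`. -/
def entireSubmodule : Submodule ℂ C(ℂ, ℂ) where
  carrier := {f | Differentiable ℂ (f : ℂ → ℂ)}
  add_mem' {f g} hf hg := by
    have h := Differentiable.add (𝕜 := ℂ) (f := (f : ℂ → ℂ)) (g := (g : ℂ → ℂ)) hf hg
    simpa using h
  zero_mem' := by
    have h : Differentiable ℂ (fun _ : ℂ => (0 : ℂ)) := differentiable_const _
    exact h
  smul_mem' c f hf := by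
    have h := Differentiable.const_smul (𝕜 := ℂ) (f := (f : ℂ → ℂ)) hf c
    simpa using h

/-- The space `H(ℂ)` of all entire functions, with its pointwise linear structure.  It carries the
topology induced by the compact-open topology of `C(ℂ, ℂ)`, i.e. the topology of uniform
convergence on compacta.  (A type of its own only in order to ease instance search.) -/
def EntireFunction : Type := entireSubmodule

namespace EntireFunction

instance : AddCommGroup EntireFunction := inferInstanceAs (AddCommGroup entireSubmodule)

instance : Module ℂ EntireFunction := inferInstanceAs (Module ℂ entireSubmodule)

instance : TopologicalSpace EntireFunction := inferInstanceAs (TopologicalSpace entireSubmodule)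

instance : IsTopologicalAddGroup EntireFunction :=
  inferInstanceAs (IsTopologicalAddGroup entireSubmodule)

instance : ContinuousSMul ℂ EntireFunction :=
  inferInstanceAs (ContinuousSMul ℂ entireSubmodule)

/-- The underlying continuous function. -/
def toContinuousMap (f : EntireFunction) : C(ℂ, ℂ) := Subtype.val f

instance : FunLike EntireFunction ℂ ℂ where
  coe f := f.toContinuousMap
  coe_injective _ _ h := Subtype.ext (DFunLike.coe_injective h)

theorem differentiable (f : EntireFunction) : Differentiable ℂ f := f.2

@[ext]
theorem ext {f g : EntireFunction} (h : ∀ z, f z = g z) : f = g := DFunLike.ext f g h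

/-- The derivative of an entire function, as an entire function. -/
def derivative (f : EntireFunction) : EntireFunction :=
  ⟨⟨deriv f, f.differentiable.deriv.continuous⟩, f.differentiable.deriv⟩

theorem tendsto_iff {ι : Type*} {l : Filter ι} {F : ι → EntireFunction} {f : EntireFunction} :
    Tendsto F l (𝓝 f) ↔ TendstoLocallyUniformly (fun i => (F i : ℂ → ℂ)) f l := by
  have h : Tendsto F l (𝓝 f) ↔ Tendsto (fun i => (F i).toContinuousMap) l (𝓝 f.toContinuousMap) :=
    tendsto_subtype_rng
  rw [h, ContinuousMap.tendsto_iff_tendstoLocallyUniformly]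
  rfl

theorem continuous_derivative : Continuous derivative := by
  rw [continuous_iff_continuousAt]
  intro f
  rw [ContinuousAt, tendsto_iff]
  have h1 : Tendsto (fun g : EntireFunction => g) (𝓝 f) (𝓝 f) := tendsto_id
  rw [tendsto_iff, ← tendstoLocallyUniformlyOn_univ] at h1
  have h2 := h1.deriv (Eventually.of_forall fun g => g.differentiable.differentiableOn) isOpen_univ
  rw [tendstoLocallyUniformlyOn_univ] at h2
  exact h2

end EntireFunction

/-- The differentiation operator `D : H(ℂ) → H(ℂ)`, a continuous linear map. -/
def diffOp : EntireFunction →L[ℂ] EntireFunction where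
  toFun := EntireFunction.derivative
  map_add' f g := by
    ext z
    exact deriv_add (f.differentiable z) (g.differentiable z)
  map_smul' c f := by
    ext z
    exact deriv_const_smul c (f.differentiable z)
  cont := EntireFunction.continuous_derivative

/-- The differential operator `P(D) = ∑ⱼ cⱼ Dʲ` on `H(ℂ)` generated by a polynomial
`P = ∑ⱼ cⱼ zʲ`. -/
def polyDiffOp (P : ℂ[X]) : EntireFunction →L[ℂ] EntireFunction :=
  aeval diffOp P

/-! ### Hypercyclic vectors and lineability -/

/-- The set `HC((Tₙ))` of hypercyclic (universal) vectors of a sequence of continuous linear maps: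
the vectors whose orbit `{Tₙ x : n}` is dense. -/
def hypercyclicVectors {𝕜 X Y : Type*} [Semiring 𝕜]
    [AddCommMonoid X] [Module 𝕜 X] [TopologicalSpace X]
    [AddCommMonoid Y] [Module 𝕜 Y] [TopologicalSpace Y] (T : ℕ → X →L[𝕜] Y) : Set X :=
  {x | Dense (Set.range fun n => T n x)}

/-- For an infinite cardinal `lam` and a cardinal `α`, the set `A` is `lam`-infinitely pointwise
`α`-dense-lineable: through every `x ∈ A` there is a family, indexed by a set of cardinality `lam`,
of dense `α`-dimensional subspaces which contain `x`, are contained in `A ∪ {0}`, and pairwise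
intersect exactly in the span of `x`. -/
def IsInfinitelyPointwiseDenseLineable (𝕜 : Type*) {X : Type u} [Field 𝕜]
    [AddCommGroup X] [Module 𝕜 X] [TopologicalSpace X]
    (lam : Cardinal.{v}) (α : Cardinal.{u}) (A : Set X) : Prop :=
  ∀ x ∈ A, ∃ (Λ : Type v) (W : Λ → Submodule 𝕜 X),
    Cardinal.mk Λ = lam ∧
    (∀ k, Dense (W k : Set X) ∧ Module.rank 𝕜 (W k) = α ∧ x ∈ W k ∧ (W k : Set X) ⊆ A ∪ {0}) ∧
    ∀ k l, k ≠ l → W k ⊓ W l = Submodule.span 𝕜 {x}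

/-! ### Growth conditions on a sequence of polynomials -/

/-- Entire functions of exponential type. -/
def IsExponentialType (Φ : ℂ → ℂ) : Prop :=
  Differentiable ℂ Φ ∧
    ∃ A > (0 : ℝ), ∃ B > (0 : ℝ), ∀ z, ‖Φ z‖ ≤ A * Real.exp (B * ‖z‖)

/-- `U` is a unicity set for the class of entire functions of exponential type. -/
def IsExpTypeUnicitySet (U : Set ℂ) : Prop :=
  ∀ f : ℂ → ℂ, IsExponentialType f → (∀ z ∈ U, f z = 0) → ∀ z, f z = 0

/-- Property (P): `|Pₙ(z)| → ∞` at every point of some unicity set. -/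
def PropertyP (P : ℕ → ℂ[X]) : Prop :=
  ∃ U : Set ℂ, IsExpTypeUnicitySet U ∧
    ∀ z ∈ U, Tendsto (fun n => ‖(P n).eval z‖) atTop atTop

/-- Property (Q), where the valence `m(n)` (the least index of a nonzero coefficient of `Pₙ`) is
`(P n).natTrailingDegree`: for each `k ≥ 1`, `m(n) |c_{m(n),n}|^{k/m(n)} → ∞` and the sequence
`(c_{k+m(n),n})ₙ` is bounded.  (The limit forces `m(n) ≥ 1` for all large `n`, so the value of the
expression at `m(n) = 0` is irrelevant.) -/
def PropertyQ (P : ℕ → ℂ[X]) : Prop :=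
  ∀ k : ℕ, 1 ≤ k →
    Tendsto (fun n => ((P n).natTrailingDegree : ℝ) *
      ‖(P n).coeff (P n).natTrailingDegree‖ ^ ((k : ℝ) / ((P n).natTrailingDegree : ℝ)))
      atTop atTop ∧
    ∃ C : ℝ, ∀ n, ‖(P n).coeff (k + (P n).natTrailingDegree)‖ ≤ C

/-- Property (R): for some `r > 0`, the minimum of `|Pₙ|` on the circle `|z| = r` tends to `∞`.
(The infimum below is over a nonempty compact set, hence it is a minimum.) -/
def PropertyR (P : ℕ → ℂ[X]) : Prop :=
  ∃ r : ℝ, 0 < r ∧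
    Tendsto (fun n => sInf ((fun z : ℂ => ‖(P n).eval z‖) '' Metric.sphere 0 r)) atTop atTop

end

/-! Let `f` be hypercyclic and let `L = Q(D) + ∑ cᵢ τ_{μᵢ}`, with translations `τ` by distinct
nonzero `μᵢ`. Each such `L` commutes with every `Pₙ(D)`. It maps `exp (a z)` to `φ(a) exp (a z)` for
an entire symbol `φ`, which is nonzero if `L` has a nonzero coefficient (`expPolySymbol_injective`).
Exponentials with frequency in the open set `φ ≠ 0` span a dense subspace, so `L` has dense range
(`denseRange_expPolyOp`) and `L f` is again hypercyclic; in particular `L ↦ L f` is injective.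

`W_k` is spanned by `f` and the vectors `P_{⌊t⌋}(D) f + ε(t) τ_{μ(k,t)} f` for real `t`. As `t ↓ n`
these tend to `Pₙ(D) f`, so the closure of `W_k` contains the dense orbit of `f`. The continuum of
values of `t` gives the dimension. Different `k` use disjoint sets of translations, so only
multiples of `f` are common to two of the spaces. -/

namespace EntireFunction

/-! ### Basic operators, exponentials and dense subspaces -/

instance : T2Space EntireFunction := inferInstanceAs (T2Space entireSubmodule)

@[simp] theorem add_apply (f g : EntireFunction) (z : ℂ) : (f + g) z = f z + g z := rfl

@[simp] theorem sub_apply (f g : EntireFunction) (z : ℂ) : (f - g) z = f z - g z := rfl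

@[simp] theorem smul_apply (c : ℂ) (f : EntireFunction) (z : ℂ) : (c • f) z = c * f z := rfl

@[simp] theorem zero_apply (z : ℂ) : (0 : EntireFunction) z = 0 := rfl

/-- An entire function given by a differentiable map. -/
noncomputable def ofDifferentiable (f : ℂ → ℂ) (hf : Differentiable ℂ f) : EntireFunction :=
  ⟨⟨f, hf.continuous⟩, hf⟩

@[simp] theorem ofDifferentiable_apply (f : ℂ → ℂ) (hf : Differentiable ℂ f) (z : ℂ) :
    ofDifferentiable f hf z = f z := rfl

/-- A family of entire functions which is jointly continuous in the parameter and the variable is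
continuous as a map into the space of entire functions. -/
theorem continuous_of_uncurry {Y : Type*} [TopologicalSpace Y] (F : Y → EntireFunction)
    (h : Continuous fun p : Y × ℂ => F p.1 p.2) : Continuous F := by
  have h1 : Continuous fun y => (F y).toContinuousMap :=
    ContinuousMap.continuous_of_continuous_uncurry _ h
  exact continuous_induced_rng.2 h1

theorem continuous_toContinuousMap : Continuous toContinuousMap := continuous_subtype_val

/-- Multiplication by an entire function. -/
noncomputable def mulLeft (g : EntireFunction) : EntireFunction →L[ℂ] EntireFunction where
  toFun f := ofDifferentiable (fun z => g z * f z) (g.differentiable.mul f.differentiable)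
  map_add' f₁ f₂ := by ext z; simp [mul_add]
  map_smul' c f := by ext z; simp [mul_left_comm]
  cont := continuous_induced_rng.2
    (continuous_const.mul continuous_toContinuousMap :
      Continuous fun f : EntireFunction => g.toContinuousMap * f.toContinuousMap)

@[simp] theorem mulLeft_apply (g f : EntireFunction) (z : ℂ) : mulLeft g f z = g z * f z := rfl

/-- The translation operator `f ↦ f (· + w)`. -/
noncomputable def translation (w : ℂ) : EntireFunction →L[ℂ] EntireFunction where
  toFun f := ofDifferentiable (fun z => f (z + w))
    (f.differentiable.comp (differentiable_id.add_const w))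
  map_add' f₁ f₂ := by ext z; simp
  map_smul' c f := by ext z; simp
  cont := continuous_induced_rng.2
    ((ContinuousMap.continuous_precomp (⟨fun z : ℂ => z + w, by fun_prop⟩ : C(ℂ, ℂ))).comp
      continuous_toContinuousMap)

@[simp] theorem translation_apply (w : ℂ) (f : EntireFunction) (z : ℂ) :
    translation w f z = f (z + w) := rfl

theorem continuous_translation (f : EntireFunction) : Continuous fun w => translation w f :=
  continuous_of_uncurry _ <| by
    have := f.differentiable.continuous
    simp only [translation_apply]
    fun_prop

theorem commute_diffOp_translation (w : ℂ) : Commute diffOp (translation w) := by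
  ext f z
  change deriv (fun z => f (z + w)) z = deriv f (z + w)
  exact deriv_comp_add_const f w z

/-- The exponential `z ↦ exp (a z)`. -/
noncomputable def expFun (a : ℂ) : EntireFunction :=
  ofDifferentiable (fun z => Complex.exp (a * z)) (by fun_prop)

@[simp] theorem expFun_apply (a z : ℂ) : expFun a z = Complex.exp (a * z) := rfl

theorem expFun_ne_zero (a : ℂ) : expFun a ≠ 0 := fun h =>
  Complex.exp_ne_zero (a * 0) (by simpa using DFunLike.congr_fun h 0)

theorem translation_expFun (w a : ℂ) :
    translation w (expFun a) = Complex.exp (w * a) • expFun a := by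
  ext z
  simp [← Complex.exp_add]
  ring_nf

theorem diffOp_expFun (a : ℂ) : diffOp (expFun a) = a • expFun a := by
  ext z
  change deriv (fun z => Complex.exp (a * z)) z = a * Complex.exp (a * z)
  have h : HasDerivAt (fun z => Complex.exp (a * z)) (Complex.exp (a * z) * (a * 1)) z :=
    ((hasDerivAt_id z).const_mul a).cexp
  rw [h.deriv]
  ring

theorem iterate_diffOp_expFun (n : ℕ) (a : ℂ) : (diffOp ^ n) (expFun a) = a ^ n • expFun a := by
  induction n with
  | zero => simp
  | succ n ih =>
    rw [pow_succ', mul_apply_eq_comp, ih, map_smul, diffOp_expFun, smul_smul, pow_succ]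

theorem polyDiffOp_expFun (Q : ℂ[X]) (a : ℂ) : polyDiffOp Q (expFun a) = Q.eval a • expFun a := by
  induction Q using Polynomial.induction_on' with
  | add p q hp hq =>
    simp only [polyDiffOp, map_add, eval_add, add_smul, _root_.add_apply] at *
    rw [hp, hq]
  | monomial n c =>
    simp only [polyDiffOp, aeval_monomial, mul_apply_eq_comp, eval_monomial,
      iterate_diffOp_expFun]
    rw [mul_smul, Algebra.algebraMap_eq_smul_one]
    rfl

/-- The entire function defined by a polynomial. -/
noncomputable def ofPolynomial : ℂ[X] →ₗ[ℂ] EntireFunction where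
  toFun Q := ofDifferentiable (fun z => Q.eval z) Q.differentiable
  map_add' p q := by ext z; simp
  map_smul' c p := by ext z; simp

@[simp] theorem ofPolynomial_apply (Q : ℂ[X]) (z : ℂ) : ofPolynomial Q z = Q.eval z := rfl

/-- Taylor partial sums at `0` converge locally uniformly. -/
theorem denseRange_ofPolynomial : DenseRange ofPolynomial := by
  intro f
  obtain ⟨p, hp⟩ : ∃ p : FormalMultilinearSeries ℂ ℂ ℂ, HasFPowerSeriesOnBall f p 0 ⊤ :=
    ⟨_, f.differentiable.hasFPowerSeriesOnBall 0 (R := 1) one_pos⟩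
  have h := hp.tendstoLocallyUniformlyOn
  rw [Metric.eball_top, tendstoLocallyUniformlyOn_univ] at h
  refine mem_closure_of_tendsto (f := fun n : ℕ => ofPolynomial
    (∑ i ∈ Finset.range n, monomial i (p.coeff i))) (b := atTop) ?_ (.of_forall fun n => ⟨_, rfl⟩)
  rw [tendsto_iff]
  convert h using 2 with n
  · ext z
    rw [ofPolynomial_apply, eval_finsetSum]
    simp [FormalMultilinearSeries.partialSum, mul_comm]
  · simp

/-- The exponentials with frequency in a nonempty open set span a dense subspace. -/
theorem dense_span_expFun {U : Set ℂ} (hU : IsOpen U) (hne : U.Nonempty) :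
    Dense (Submodule.span ℂ (expFun '' U) : Set EntireFunction) := by
  set M := (Submodule.span ℂ (expFun '' U)).topologicalClosure with hM
  -- The closed span is stable under differentiation in the frequency, and each such derivative
  -- brings down a factor `z`.
  have hpow : ∀ n : ℕ, ∀ a ∈ U, mulLeft (expFun a) (ofPolynomial (X ^ n)) ∈ M := by
    intro n
    induction n with
    | zero =>
      intro a ha
      have : mulLeft (expFun a) (ofPolynomial (X ^ 0)) = expFun a := by ext z; simp
      rw [this]
      exact Submodule.le_topologicalClosure _ (Submodule.subset_span ⟨a, ha, rfl⟩)
    | succ n ih =>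
      intro a ha
      have hE : Differentiable ℂ (dslope Complex.exp 0) := by
        rw [← differentiableOn_univ, Complex.differentiableOn_dslope univ_mem]
        exact Complex.differentiable_exp.differentiableOn
      have hEc := hE.continuous
      -- The difference quotient in the frequency, with `dslope` filling in its value at `h = 0`.
      let G : ℂ → EntireFunction := fun h => mulLeft (expFun a) (ofDifferentiable
        (fun z => z ^ (n + 1) * dslope Complex.exp 0 (h * z))
        ((differentiable_pow _).mul (hE.comp (differentiable_id.const_mul h))))
      have hG : Continuous G := continuous_of_uncurry _ <| by
        simp only [G, mulLeft_apply, expFun_apply, ofDifferentiable_apply]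
        fun_prop
      have hG0 : G 0 = mulLeft (expFun a) (ofPolynomial (X ^ (n + 1))) := by
        ext z
        simp [G]
      have hGne : ∀ h, h ≠ 0 → G h = h⁻¹ • (mulLeft (expFun (a + h)) (ofPolynomial (X ^ n)) -
          mulLeft (expFun a) (ofPolynomial (X ^ n))) := by
        intro h hh
        ext z
        rcases eq_or_ne z 0 with rfl | hz
        · simp [G]
        · simp only [G, mulLeft_apply, expFun_apply, ofDifferentiable_apply, smul_apply, sub_apply,
            ofPolynomial_apply, eval_pow, eval_X, dslope_of_ne _ (mul_ne_zero hh hz), slope,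
            add_mul, Complex.exp_add]
          simp
          field_simp
          ring
      rw [← hG0]
      refine (Submodule.isClosed_topologicalClosure _).mem_of_tendsto (b := 𝓝[≠] 0)
        (hG.continuousAt.mono_left nhdsWithin_le_nhds) ?_
      have hev : ∀ᶠ h in 𝓝 (0 : ℂ), a + h ∈ U :=
        (by fun_prop : Continuous fun h : ℂ => a + h).continuousAt.eventually_mem
          (hU.mem_nhds (by simpa using ha))
      filter_upwards [hev.filter_mono nhdsWithin_le_nhds, self_mem_nhdsWithin] with h h1 h2
      rw [hGne h h2]
      exact M.smul_mem _ (M.sub_mem (ih _ h1) (ih _ ha))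
  obtain ⟨a, ha⟩ := hne
  have hpoly : ∀ Q : ℂ[X], mulLeft (expFun a) (ofPolynomial Q) ∈ M := by
    intro Q
    induction Q using Polynomial.induction_on' with
    | add p q hp hq => simpa using M.add_mem hp hq
    | monomial n c =>
      rw [← mul_one c, ← smul_eq_mul, ← smul_monomial, map_smul, map_smul,
        monomial_one_right_eq_X_pow]
      exact M.smul_mem _ (hpow n a ha)
  -- Multiplication by an exponential is invertible, so it carries the dense set of polynomials to a
  -- dense set.
  have hsurj : Function.Surjective (mulLeft (expFun a)) := fun g =>
    ⟨mulLeft (expFun (-a)) g, by ext z; simp [← mul_assoc, ← Complex.exp_add]⟩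
  have hd : DenseRange fun Q => mulLeft (expFun a) (ofPolynomial Q) :=
    hsurj.denseRange.comp denseRange_ofPolynomial (mulLeft (expFun a)).continuous
  have hMtop : Dense (M : Set EntireFunction) := hd.mono (Set.range_subset_iff.2 hpoly)
  rwa [hM, Submodule.topologicalClosure_coe, dense_closure] at hMtop

/-! ### Operators combining differentiation and translations, and their symbols -/

variable {ι : Type*}

/-- The operator `Q(D) + ∑ᵢ cᵢ τ_{μᵢ}` attached to the pair `(Q, c)`. -/
noncomputable def expPolyOp (μ : ι → ℂ) : (ℂ[X] × (ι →₀ ℂ)) →ₗ[ℂ]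
    (EntireFunction →L[ℂ] EntireFunction) :=
  (aeval diffOp : ℂ[X] →ₐ[ℂ] _).toLinearMap.coprod
    (Finsupp.linearCombination ℂ fun i => translation (μ i))

/-- The symbol `Q(z) + ∑ᵢ cᵢ exp (μᵢ z)` of the operator `Q(D) + ∑ᵢ cᵢ τ_{μᵢ}`. -/
noncomputable def expPolySymbol (μ : ι → ℂ) : (ℂ[X] × (ι →₀ ℂ)) →ₗ[ℂ] EntireFunction :=
  ofPolynomial.coprod (Finsupp.linearCombination ℂ fun i => expFun (μ i))

theorem expPolyOp_apply (μ : ι → ℂ) (v : ℂ[X] × (ι →₀ ℂ)) :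
    expPolyOp μ v = polyDiffOp v.1 + v.2.sum fun i a => a • translation (μ i) := rfl

theorem expPolySymbol_apply (μ : ι → ℂ) (v : ℂ[X] × (ι →₀ ℂ)) :
    expPolySymbol μ v = ofPolynomial v.1 + v.2.sum fun i a => a • expFun (μ i) := rfl

theorem expPolyOp_expFun (μ : ι → ℂ) (v : ℂ[X] × (ι →₀ ℂ)) (a : ℂ) :
    expPolyOp μ v (expFun a) = expPolySymbol μ v a • expFun a := by
  obtain ⟨Q, c⟩ := v
  have h : (expPolyOp μ (0, c)) (expFun a) = expPolySymbol μ (0, c) a • expFun a := by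
    induction c using Finsupp.induction_linear with
    | zero => simp [← Prod.zero_eq_mk]
    | add c d hc hd =>
      rw [← add_zero (0 : ℂ[X]), ← Prod.mk_add_mk, map_add, map_add, _root_.add_apply, hc, hd,
        add_apply, add_smul]
    | single i b =>
      simp [expPolyOp, expPolySymbol, translation_expFun, smul_smul]
  have hQ : (expPolyOp μ (Q, 0)) (expFun a) = expPolySymbol μ (Q, 0) a • expFun a := by
    simp [expPolyOp_apply, expPolySymbol_apply, polyDiffOp_expFun]
  have hs : (Q, c) = (Q, 0) + (0, c) := by simp
  rw [hs, map_add, map_add, _root_.add_apply, h, hQ, add_apply, add_smul]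

theorem iterate_diffOp_ofPolynomial (n : ℕ) (Q : ℂ[X]) :
    (diffOp ^ n) (ofPolynomial Q) = ofPolynomial (Polynomial.derivative^[n] Q) := by
  induction n with
  | zero => simp
  | succ n ih =>
    rw [pow_succ', mul_apply_eq_comp, ih, Function.iterate_succ_apply']
    ext z
    exact Polynomial.deriv _

/-- Eigenvectors of `D` for distinct eigenvalues. -/
theorem linearIndependent_expFun {μ : ι → ℂ} (hμ : Function.Injective μ) :
    LinearIndependent ℂ fun i => expFun (μ i) :=
  Module.End.eigenvectors_linearIndependent' (diffOp : EntireFunction →ₗ[ℂ] EntireFunction) μ hμ _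
    fun i => ⟨Module.End.mem_eigenspace_iff.2 (diffOp_expFun (μ i)), expFun_ne_zero _⟩

theorem expPolySymbol_injective {μ : ι → ℂ} (hμ : Function.Injective μ) (h0 : ∀ i, μ i ≠ 0) :
    Function.Injective (expPolySymbol μ) := by
  rw [injective_iff_map_eq_zero]
  rintro ⟨Q, c⟩ h
  rw [expPolySymbol_apply] at h
  -- Enough derivatives kill `Q` and multiply each `cᵢ` by a power of `μᵢ ≠ 0`.
  have h1 := congrArg (diffOp ^ (Q.natDegree + 1)) h
  rw [map_add, iterate_diffOp_ofPolynomial,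
    Polynomial.iterate_derivative_eq_zero (Nat.lt_succ_self _), map_zero, zero_add, map_zero,
    Finsupp.sum, map_sum] at h1
  simp only [map_smul, iterate_diffOp_expFun, smul_smul] at h1
  have hc : c = 0 := by
    ext i
    by_contra hi
    have := linearIndependent_iff'.1 (linearIndependent_expFun hμ) _ _ h1 i
      (Finsupp.mem_support_iff.2 hi)
    exact mul_ne_zero hi (pow_ne_zero _ (h0 i)) this
  subst hc
  have hQ : Q = 0 := Polynomial.funext fun z => by
    simpa using DFunLike.congr_fun h z
  rw [hQ]
  rfl

/-- A nonzero operator `Q(D) + ∑ᵢ cᵢ τ_{μᵢ}` has dense range. -/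
theorem denseRange_expPolyOp {μ : ι → ℂ} (hμ : Function.Injective μ) (h0 : ∀ i, μ i ≠ 0)
    {v : ℂ[X] × (ι →₀ ℂ)} (hv : v ≠ 0) : DenseRange (expPolyOp μ v) := by
  set φ := expPolySymbol μ v with hφ
  have hφ0 : φ ≠ 0 := by rwa [hφ, Ne, (expPolySymbol_injective hμ h0).eq_iff' (map_zero _)]
  obtain ⟨a, ha⟩ : ∃ a, φ a ≠ 0 := by
    by_contra! h
    exact hφ0 (ext h)
  have hU : IsOpen {a | φ a ≠ 0} := isOpen_ne_fun φ.differentiable.continuous continuous_const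
  refine (dense_span_expFun hU ⟨a, ha⟩).mono ?_
  change _ ≤ (LinearMap.range (expPolyOp μ v : EntireFunction →ₗ[ℂ] EntireFunction) :
    Submodule ℂ EntireFunction)
  rw [Submodule.span_le]
  rintro _ ⟨b, hb, rfl⟩
  refine ⟨(φ b)⁻¹ • expFun b, ?_⟩
  have hb' : φ b ≠ 0 := hb
  rw [map_smul]
  change (φ b)⁻¹ • expPolyOp μ v (expFun b) = _
  rw [expPolyOp_expFun, smul_smul, inv_mul_cancel₀ hb', one_smul]

theorem commute_polyDiffOp_expPolyOp (μ : ι → ℂ) (P : ℂ[X]) (v : ℂ[X] × (ι →₀ ℂ)) :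
    Commute (polyDiffOp P) (expPolyOp μ v) := by
  rw [expPolyOp_apply]
  refine Commute.add_right ?_ (Commute.sum_right _ _ _ fun i _ => Commute.smul_right ?_ _)
  · rw [polyDiffOp, polyDiffOp, Commute, SemiconjBy, ← map_mul, mul_comm, map_mul]
  · induction P using Polynomial.induction_on' with
    | add p q hp hq =>
      rw [polyDiffOp, map_add]
      exact hp.add_left hq
    | monomial n c =>
      rw [polyDiffOp, aeval_monomial]
      exact Commute.mul_left (Algebra.commutes c _)
        ((commute_diffOp_translation _).pow_left n)

end EntireFunction

/-! ### Hypercyclic vectors -/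

/-- The image of a hypercyclic vector under an operator of dense range which commutes with the
sequence is again hypercyclic. -/
theorem apply_mem_hypercyclicVectors {𝕜 X : Type*} [Semiring 𝕜] [AddCommMonoid X] [Module 𝕜 X]
    [TopologicalSpace X] {T : ℕ → X →L[𝕜] X} {L : X →L[𝕜] X} (hL : DenseRange L)
    (hT : ∀ n x, T n (L x) = L (T n x)) {x : X} (hx : x ∈ hypercyclicVectors T) :
    L x ∈ hypercyclicVectors T := by
  have h : DenseRange (L ∘ fun n => T n x) := hL.comp hx L.continuous
  have he : (fun n => T n (L x)) = L ∘ fun n => T n x := funext fun n => hT n x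
  change DenseRange fun n => T n (L x)
  rwa [he]

theorem zero_notMem_hypercyclicVectors {𝕜 X : Type*} [Semiring 𝕜] [AddCommMonoid X] [Module 𝕜 X]
    [TopologicalSpace X] [T1Space X] [Nontrivial X] (T : ℕ → X →L[𝕜] X) :
    (0 : X) ∉ hypercyclicVectors T := by
  intro h
  have h1 : Dense ({0} : Set X) := by simpa [hypercyclicVectors] using h
  obtain ⟨x, hx⟩ := exists_ne (0 : X)
  have := h1.closure_eq ▸ Set.mem_univ x
  exact hx (by simpa using this)

/-! ### The parametrized spaces of operators -/

namespace EntireFunction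

instance : Nontrivial EntireFunction := ⟨_, _, expFun_ne_zero 0⟩

/-- The frequencies `exp k + i t`, which are distinct, nonzero and lie on a different vertical line
for each `k`. -/
noncomputable def frequency (p : ℝ × ℝ) : ℂ := ⟨Real.exp p.1, p.2⟩

theorem frequency_injective : Function.Injective frequency := by
  rintro ⟨k, t⟩ ⟨l, s⟩ h
  have h1 := congrArg Complex.re h
  have h2 := congrArg Complex.im h
  exact Prod.ext (Real.exp_injective h1) h2

theorem frequency_ne_zero (p : ℝ × ℝ) : frequency p ≠ 0 := fun h =>
  (Real.exp_pos p.1).ne' (congrArg Complex.re h)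

theorem continuous_frequency : Continuous frequency := by
  have : frequency = fun p => (Real.exp p.1 : ℂ) + p.2 * Complex.I := by
    ext p
    simp [frequency, Complex.ext_iff, -Complex.ofReal_exp]
  rw [this]
  fun_prop

/-- The fractional part, with the value `0` replaced by `1`. -/
noncomputable def fractOrOne (t : ℝ) : ℝ := if Int.fract t = 0 then 1 else Int.fract t

/-- This makes `d` recoverable from the translation coefficients, integer `t` included. -/
theorem fractOrOne_ne_zero (t : ℝ) : fractOrOne t ≠ 0 := by
  unfold fractOrOne
  split_ifs with h
  exacts [one_ne_zero, h]

/-- Parametrization `(a, d) ↦ a + ∑ₜ dₜ (P_{⌊t⌋}(D) + ε(t) τ_{exp k + i t})` of a space of operators,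
where `ε` is `fractOrOne`. -/
noncomputable def perturbedSpan (P : ℕ → ℂ[X]) (k : ℝ) :
    (ℂ × (ℝ →₀ ℂ)) →ₗ[ℂ] ℂ[X] × (ℝ × ℝ →₀ ℂ) :=
  ((LinearMap.toSpanSingleton ℂ ℂ[X] 1).coprod
      (Finsupp.linearCombination ℂ fun t : ℝ => P ⌊t⌋₊)).prod
    ((Finsupp.linearCombination ℂ fun t : ℝ =>
      Finsupp.single (k, t) (fractOrOne t : ℂ)).comp (LinearMap.snd ℂ _ _))

theorem perturbedSpan_snd_apply (P : ℕ → ℂ[X]) (k l : ℝ) (w : ℂ × (ℝ →₀ ℂ)) (t : ℝ) :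
    (perturbedSpan P k w).2 (l, t) = if k = l then w.2 t * fractOrOne t else 0 := by
  have h : (perturbedSpan P k w).2 =
      w.2.sum fun s a => a • Finsupp.single (k, s) (fractOrOne s : ℂ) := rfl
  rw [h, Finsupp.sum, Finsupp.finsetSum_apply]
  simp only [Finsupp.smul_apply, Finsupp.single_apply, Prod.mk.injEq, smul_eq_mul]
  split_ifs with hkl
  · simp only [hkl, true_and, mul_ite, mul_zero, Finset.sum_ite_eq', Finsupp.mem_support_iff]
    split_ifs with h0
    · rfl
    · rw [not_not.1 h0, zero_mul]
  · simp [hkl]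

theorem perturbedSpan_of_snd_eq_zero (P : ℕ → ℂ[X]) (k : ℝ) {w : ℂ × (ℝ →₀ ℂ)}
    (h : ∀ t, (perturbedSpan P k w).2 (k, t) = 0) : w = (w.1, 0) := by
  refine Prod.ext rfl (Finsupp.ext fun t => ?_)
  simpa [perturbedSpan_snd_apply, fractOrOne_ne_zero] using h t

theorem perturbedSpan_const (P : ℕ → ℂ[X]) (k : ℝ) (a : ℂ) :
    perturbedSpan P k (a, 0) = a • (1, 0) := by
  simp [perturbedSpan]

theorem perturbedSpan_single (P : ℕ → ℂ[X]) (k t : ℝ) :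
    perturbedSpan P k (0, Finsupp.single t 1) =
      (P ⌊t⌋₊, Finsupp.single (k, t) (fractOrOne t : ℂ)) := by
  simp [perturbedSpan]

theorem perturbedSpan_injective (P : ℕ → ℂ[X]) (k : ℝ) :
    Function.Injective (perturbedSpan P k) := by
  rw [injective_iff_map_eq_zero]
  intro w hw
  have h := perturbedSpan_of_snd_eq_zero P k (w := w) fun t => by rw [hw]; rfl
  rw [h, perturbedSpan_const] at hw
  have : w.1 = 0 := by simpa using congrArg Prod.fst hw
  rw [h, this]
  rfl

/-- For `0 < s < 1` the index stays `n` and the translation has weight `s`, while its frequency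
stays bounded as `s ↓ 0`. -/
theorem tendsto_perturbedSpan (P : ℕ → ℂ[X]) (k : ℝ) (f : EntireFunction) (n : ℕ) :
    Tendsto (fun s : ℝ => expPolyOp frequency
      (perturbedSpan P k (0, Finsupp.single (n + s) 1)) f) (𝓝[>] 0) (𝓝 (polyDiffOp (P n) f)) := by
  have h : Tendsto (fun s : ℝ => polyDiffOp (P n) f +
      (s : ℂ) • translation (frequency (k, n + s)) f) (𝓝 0) (𝓝 (polyDiffOp (P n) f)) := by
    have hc : Continuous fun s : ℝ => polyDiffOp (P n) f +
        (s : ℂ) • translation (frequency (k, n + s)) f := by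
      have h1 : Continuous fun s : ℝ => translation (frequency (k, n + s)) f :=
        (continuous_translation f).comp (continuous_frequency.comp (by fun_prop))
      exact continuous_const.add (Complex.continuous_ofReal.smul h1)
    simpa using hc.tendsto 0
  refine (h.mono_left nhdsWithin_le_nhds).congr' ?_
  filter_upwards [Ioo_mem_nhdsGT (zero_lt_one (α := ℝ))] with s hs
  have h1 : Int.fract ((n : ℝ) + s) = s := by
    rw [Int.fract_natCast_add, Int.fract_eq_self.2 ⟨hs.1.le, hs.2⟩]
  have h2 : ⌊(n : ℝ) + s⌋₊ = n := by
    rw [Nat.floor_eq_iff (by have := hs.1; positivity)]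
    constructor <;> linarith [hs.1, hs.2]
  rw [perturbedSpan_single, h2, fractOrOne, h1, if_neg hs.1.ne', expPolyOp_apply]
  simp [Complex.coe_smul]
  rfl

end EntireFunction

/- The growth hypotheses serve to make the set of hypercyclic vectors nonempty. The construction of
the subspaces through a given hypercyclic vector `f` needs only that each `P(D)` commutes with the
operators `Q(D) + ∑ᵢ cᵢ τ_{μᵢ}`, which have dense range unless they vanish. -/
open EntireFunction in
theorem theorem4p4 (P : ℕ → ℂ[X])
    (hP : ∀ n, 0 < (P n).natDegree)
    (ha : ¬ BddAbove (Set.range fun n => (P n).natTrailingDegree))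
    (hb : PropertyP P ∨ PropertyQ P ∨ PropertyR P) :
    IsInfinitelyPointwiseDenseLineable ℂ Cardinal.continuum.{0} Cardinal.continuum.{0}
      (hypercyclicVectors fun n => polyDiffOp (P n)) := by
  intro f hf
  have hmem : ∀ v : ℂ[X] × (ℝ × ℝ →₀ ℂ), v ≠ 0 →
      expPolyOp frequency v f ∈ hypercyclicVectors fun n => polyDiffOp (P n) := fun v hv =>
    apply_mem_hypercyclicVectors (denseRange_expPolyOp frequency_injective frequency_ne_zero hv)
      (fun n x => DFunLike.congr_fun (commute_polyDiffOp_expPolyOp frequency (P n) v).eq x) hf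
  let E : (ℂ[X] × (ℝ × ℝ →₀ ℂ)) →ₗ[ℂ] EntireFunction :=
    { toFun := fun v => expPolyOp frequency v f
      map_add' := fun v w => by rw [map_add]; rfl
      map_smul' := fun c v => by rw [map_smul]; rfl }
  have hE : Function.Injective E := by
    rw [injective_iff_map_eq_zero]
    intro v hv
    by_contra h
    exact zero_notMem_hypercyclicVectors _ (hv ▸ hmem v h)
  have hE1 : ∀ a : ℂ, E (a • (1, 0)) = a • f := fun a => by
    rw [map_smul]
    simp [E, expPolyOp_apply, polyDiffOp]
  have hEk : ∀ k a, (E ∘ₗ perturbedSpan P k) (a, 0) = a • f := fun k a => by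
    rw [LinearMap.comp_apply, perturbedSpan_const, hE1]
  refine ⟨ℝ, fun k => LinearMap.range (E ∘ₗ perturbedSpan P k), Cardinal.mk_real,
    fun k => ⟨?_, ?_, ?_, ?_⟩, fun k l hkl => le_antisymm ?_ ?_⟩
  · refine dense_closure.1 (Dense.mono ?_ hf)
    rintro _ ⟨n, rfl⟩
    exact mem_closure_of_tendsto (tendsto_perturbedSpan P k f n) (.of_forall fun s => ⟨_, rfl⟩)
  · rw [rank_range_of_injective (E ∘ₗ perturbedSpan P k)
      (hE.comp (perturbedSpan_injective P k) :), rank_prod', Module.rank_self,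
      rank_finsupp_self', Cardinal.mk_real]
    exact Cardinal.add_eq_right Cardinal.aleph0_le_continuum
      (Cardinal.one_le_aleph0.trans Cardinal.aleph0_le_continuum)
  · exact ⟨(1, 0), by rw [hEk, one_smul]⟩
  · rintro _ ⟨w, rfl⟩
    by_cases h : perturbedSpan P k w = 0
    · right
      simp [h]
    · exact Or.inl (hmem _ h)
  · rintro _ ⟨⟨w, rfl⟩, ⟨w', hw'⟩⟩
    have hw : perturbedSpan P l w' = perturbedSpan P k w := hE hw'
    -- Row `k` of the translation coefficients vanishes because the element also comes from row `l ≠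
    -- k`; only the scalar part of `w` survives.
    rw [perturbedSpan_of_snd_eq_zero P k (w := w) fun t => by
      rw [← hw, perturbedSpan_snd_apply, if_neg hkl.symm], hEk]
    exact Submodule.smul_mem _ _ (Submodule.mem_span_singleton_self f)
  · rw [Submodule.span_singleton_le_iff_mem]
    exact ⟨⟨(1, 0), by rw [hEk, one_smul]⟩, ⟨(1, 0), by rw [hEk, one_smul]⟩⟩
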